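/- Let $V$ be a vocabulary and let $\mathcal M_s$ (draft model) and $\mathcal M_b$ (target model) be language models, i.e. for every finite context $c$ they give probability distributions $\mathcal M_s(\cdot|c)$ and $\mathcal M_b(\cdot|c)$ of the next token on $V$. Let $X_0$ be a prefix, let $\gamma\ge 0$, and let $\alpha=(X_0,X_1,\dots,X_\gamma)$ be a random draft chain with $X_i\sim\mathcal M_s(\cdot|X^{i-1})$, where $X^i=(X_0,\dots,X_i)$. A chain verification algorithm takes $\alpha,\mathcal M_s,\mathcal M_b$ and, possibly using internal randomness, returns an accepted part $X^\tau$ of $\alpha$ with $0\le\tau\le\gamma$ and an additional token $Y$; its number of accepted tokens is $N=\tau$. It is valid for $(\mathcal M_s,\mathcal M_b,X_0,\gamma)$ if $(X^\tau,Y)\sim\mathcal M_b(\cdot|X_0)$, in the sense that the sequence obtained by continuing $(X^\tau,Y)$ with tokens generated by $\mathcal M_b$ has the law of a sequence generated by $\mathcal M_b$ from $X_0$. Put $p_0=1$, $p_i=\min\{p_{i-1}\mathcal M_b(X_i|X^{i-1})/\mathcal M_s(X_i|X^{i-1}),1\}$ for $1\le i\le\gamma$, and for $0\le i<\gamma$ $$S_i=\sum_{x\in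 V}[p_i\mathcal M_b(x|X^i)-\mathcal M_s(x|X^i)]_+,\qquad h_i=\frac{S_i}{S_i+1-p_i},\qquad R_i(x)=\frac{[p_i\mathcal M_b(x|X^i)-\mathcal M_s(x|X^i)]_+}{S_i},$$ and $h_\gamma=p_\gamma$. Block Verification draws independent $\eta_1,\dots,\eta_\gamma\sim U(0,1)$, lets $\tau$ be the largest $i\in\{1,\dots,\gamma\}$ with $\eta_i\le h_i$ ($\tau=0$ if there is none), and draws $Y$ from $\mathcal M_b(\cdot|X^\gamma)$ if $\tau=\gamma$ and from $R_\tau$ otherwise. Traversal Verification is defined for token trees; each node starts with the acceptance rate $p$ given along its path from the root by the recursion for $p_i$. While the tree is non-empty it takes the chain $(X_0,\dots,X_k)$ from the root to the first leaf and draws $\eta\sim U(0,1)$. If $\eta<p(X_k)$, it accepts this chain and stops. Otherwise it deletes $X_k$ and, if $k\ge1$, with $p=p(X_{k-1})$ and $S=\sum_x[p\,\mathcal M_b(x|X^{k-1})-\mathcal M_s(x|X^{k-1})]_+$ it replaces $p(X_{k-1})$ by $S/(S+1-p)$, $\mathcal M_b(\cdot|X^{k-1})$ by $[p\,\mathcal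 M_b(\cdot|X^{k-1})-\mathcal M_s(\cdot|X^{k-1})]_+/S$, and $\mathcal M_s(\cdot|X^{k-1})$ by its renormalisation after setting the mass of $X_k$ to $0$, and recomputes the rates of the remaining descendants of $X_{k-1}$ by the same recursion. If the tree becomes empty, $\tau=0$. Finally $Y$ is drawn from the current $\mathcal M_b(\cdot|X^\tau)$. Theorem (single-chain optimality). For all $\mathcal M_s,\mathcal M_b,X_0,\gamma$, when the sampling tree is the single chain $\alpha$, the numbers of accepted tokens of Traversal Verification, of Block Verification and of any chain verification algorithm VERIFY that is valid for $(\mathcal M_s,\mathcal M_b,X_0,\gamma)$ (in particular, of any algorithm that is valid for all models) satisfy $$\mathbb E[N_{\rm traversal}]=\mathbb E[N_{\rm block}]\ge\mathbb E[N_{\rm verify}],$$ where the expectation is over the draft chain and the internal randomness of the algorithms. -/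

import Mathlib

open scoped ENNReal

/-- A language model over the vocabulary `V`: `M c` is the law `M(· | c)` of the next token after
the context `c`. -/
abbrev LanguageModel (V : Type*) := List V → PMF V

/-- The law of `n` tokens generated one after the other by `M` from the context `c`:
the sequence `x₁, …, xₙ` has probability `∏ k, M(x_k | c, x₁, …, x_{k-1})`. -/
noncomputable def generate {V : Type*} (M : LanguageModel V) : List V → ℕ → PMF (List V)
  | _, 0 => PMF.pure []
  | c, n + 1 => (M c).bind fun t => (generate M (c ++ [t]) n).map fun z => t :: z

/-- Draw `η ∼ U(0,1)`, continue as `P` if `η < p` and as `Q` otherwise. -/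
noncomputable def withProb {Ω : Type*} (p : ℝ≥0∞) (P Q : PMF Ω) : PMF Ω :=
  ⟨fun ω => min p 1 * P ω + (1 - min p 1) * Q ω, by
    have h : ∑' ω, (min p 1 * P ω + (1 - min p 1) * Q ω) = 1 := by
      rw [ENNReal.tsum_add, ENNReal.tsum_mul_left, ENNReal.tsum_mul_left, P.tsum_coe, Q.tsum_coe,
        mul_one, mul_one, add_tsub_cancel_of_le (min_le_right p 1)]
    exact ENNReal.summable.hasSum_iff.2 h⟩

/-- `norm(f) = f / ∑ f`; the value `q` is used when `f` cannot be normalised. -/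
noncomputable def normalizeOr {V : Type*} (f : V → ℝ≥0∞) (q : PMF V) : PMF V :=
  open scoped Classical in
  if h : (∑' x, f x) ≠ 0 ∧ (∑' x, f x) ≠ ∞ then PMF.normalize f h.1 h.2 else q

/-- The unnormalised residual `[p · b(x) - s(x)]₊`; subtraction in `ℝ≥0∞` is truncated at `0`. -/
noncomputable def excess {V : Type*} (p : ℝ≥0∞) (b s : PMF V) (x : V) : ℝ≥0∞ := p * b x - s x

/-- The probability `∑ₓ [p b(x) - s(x)]₊ / (∑ₓ [p b(x) - s(x)]₊ + 1 - p)`. -/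
noncomputable def residualRate {V : Type*} (p : ℝ≥0∞) (b s : PMF V) : ℝ≥0∞ :=
  (∑' x, excess p b s x) / ((∑' x, excess p b s x) + (1 - p))

/-- If the node `c` has acceptance rate `r`, then `rateAlong s b c r w` is the rate of its descendant
`c ++ w` given by `p(x_i) = min {p(x_{i-1}) · b(x_i | x^{i-1}) / s(x_i | x^{i-1}), 1}`. -/
noncomputable def rateAlong {V : Type*} (s b : List V → PMF V) :
    List V → ℝ≥0∞ → List V → ℝ≥0∞
  | _, r, [] => r
  | c, r, x :: w => rateAlong s b (c ++ [x]) (min (r * b c x / s c x) 1) w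

/-- Finite ordered forests with nodes labelled by tokens, in first-child / next-sibling form.
A token tree is given by the forest of subtrees below its root; the root itself carries the prompt. -/
inductive Forest (V : Type*) where
  | nil : Forest V
  | cons (token : V) (children siblings : Forest V) : Forest V

namespace Forest

/-- The number of nodes below the root. -/
def size {V : Type*} : Forest V → ℕ
  | nil => 0
  | cons _ c s => c.size + s.size + 1

/-- The chain from the root to the first leaf (the tokens below the root). -/
def firstChain {V : Type*} : Forest V → List V
  | nil => []
  | cons t c _ => t :: c.firstChain

/-- Remove the first leaf. -/
def deleteFirstLeaf {V : Type*} : Forest V → Forest V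
  | nil => nil
  | cons _ nil s => s
  | cons t (cons t' c' s') s => cons t (cons t' c' s').deleteFirstLeaf s

theorem size_deleteFirstLeaf_lt {V : Type*} :
    ∀ F : Forest V, F ≠ nil → F.deleteFirstLeaf.size < F.size
  | nil, h => absurd rfl h
  | cons _ nil s, _ => by simp [deleteFirstLeaf, size]
  | cons t (cons t' c' s') s, _ => by
      have := size_deleteFirstLeaf_lt (cons t' c' s') (by simp)
      simp only [deleteFirstLeaf, size] at this ⊢
      omega

/-- The tree that consists of a single chain. -/
def chain {V : Type*} : List V → Forest V
  | [] => nil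
  | t :: w => cons t (chain w) nil

end Forest

open scoped Classical in
/-- The main loop of Traversal Verification. A node is identified with the tokens on its path from
the root. The loop carries the current draft laws `s`, target laws `b`, acceptance rates `p`, and
the remaining tree, whose part below the root is `F`. The result is the accepted chain together with
the additional token. -/
noncomputable def traversalLoop {V : Type*} (s b : List V → PMF V)
    (p : List V → ℝ≥0∞) (F : Forest V) : PMF (List V × V) :=
  let α := F.firstChain
  withProb (p α)
    -- accept the first chain
    ((b α).map fun y => (α, y))
    -- delete the last node of the first chain
    (if F = .nil then
      -- that node is the root, so the tree is empty now and nothing has been accepted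
      (b []).map fun y => ([], y)
    else
      let c := α.dropLast
      let s' := Function.update s c
        (normalizeOr (fun x => if some x = α.getLast? then 0 else s c x) (s c))
      let b' := Function.update b c (normalizeOr (excess (p c) (b c) (s c)) (b c))
      let p' := fun w =>
        if c <+: w then rateAlong s' b' c (residualRate (p c) (b c) (s c)) (w.drop c.length)
        else p w
      traversalLoop s' b' p' F.deleteFirstLeaf)
termination_by F.size
decreasing_by exact Forest.size_deleteFirstLeaf_lt F ‹_›

/-- Traversal Verification of a token tree with root `X₀`. -/
noncomputable def traversalVerification {V : Type*} (Ms Mb : LanguageModel V)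
    (X₀ : List V) (F : Forest V) : PMF (List V × V) :=
  let s := fun w => Ms (X₀ ++ w)
  let b := fun w => Mb (X₀ ++ w)
  traversalLoop s b (fun w => rateAlong s b [] 1 w) F

/-- The probability `h_i` with which Block Verification marks the block `x₁, …, x_i`. -/
noncomputable def blockRate {V : Type*} (Ms Mb : LanguageModel V) (X₀ x : List V) (i : ℕ) :
    ℝ≥0∞ :=
  let p := rateAlong (fun w => Ms (X₀ ++ w)) (fun w => Mb (X₀ ++ w)) [] 1 (x.take i)
  if i = x.length then p
  else residualRate p (Mb (X₀ ++ x.take i)) (Ms (X₀ ++ x.take i))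

/-- The law of the variable `τ` of Block Verification after `n` rounds: it starts at `0`, and round
`i = 1, …, n` sets it to `i` with probability `h_i`. -/
noncomputable def blockLength {V : Type*} (Ms Mb : LanguageModel V) (X₀ x : List V) : ℕ → PMF ℕ
  | 0 => PMF.pure 0
  | i + 1 => (blockLength Ms Mb X₀ x i).bind fun τ =>
      withProb (blockRate Ms Mb X₀ x (i + 1)) (PMF.pure (i + 1)) (PMF.pure τ)

/-- Block Verification of the draft chain `x` with root `X₀`. -/
noncomputable def blockVerification {V : Type*} (Ms Mb : LanguageModel V) (X₀ x : List V) :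
    PMF (List V × V) :=
  (blockLength Ms Mb X₀ x x.length).bind fun τ =>
    let p := rateAlong (fun w => Ms (X₀ ++ w)) (fun w => Mb (X₀ ++ w)) [] 1 (x.take τ)
    let b := Mb (X₀ ++ x.take τ)
    let s := Ms (X₀ ++ x.take τ)
    (if τ = x.length then b else normalizeOr (excess p b s) b).map fun y => (x.take τ, y)

/-- A (randomised) chain verification algorithm: from the two models, the root `X₀` and the draft
chain `x` it produces an accepted chain, which is an initial part of `x`, and an additional token. -/
structure ChainVerifier (V : Type*) where
  run : LanguageModel V → LanguageModel V → List V → List V → PMF (List V × V)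
  accepted_subchain : ∀ Ms Mb X₀ x, ∀ o ∈ (run Ms Mb X₀ x).support, o.1 <+: x

/-- Validity (losslessness): for a draft chain of depth `γ` sampled from `Ms`, the output
`(X^τ, Y)` is distributed as `Mb(· | X₀)`. As the output has random length, this means that the
sequence obtained by letting `Mb` continue after `(X^τ, Y)` has the law of a sequence generated by
`Mb`: for every `n` its first `n` tokens do. -/
def ChainVerifier.IsValid {V : Type*} (A : ChainVerifier V) (Ms Mb : LanguageModel V)
    (X₀ : List V) (γ : ℕ) : Prop :=
  ∀ n : ℕ,
    ((generate Ms X₀ γ).bind fun x => (A.run Ms Mb X₀ x).bind fun o =>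
      (generate Mb (X₀ ++ o.1 ++ [o.2]) n).map fun z => (o.1 ++ o.2 :: z).take n) =
    generate Mb X₀ n

/-- The expected number of accepted tokens when the draft chain of depth `γ` is sampled from `Ms`
and then verified by `A`, over the randomness of the chain and of the algorithm. -/
noncomputable def expectedAccepted {V : Type*} (Ms : LanguageModel V) (X₀ : List V) (γ : ℕ)
    (A : List V → PMF (List V × V)) : ℝ≥0∞ :=
  ∑' o : List V × V, ((generate Ms X₀ γ).bind A) o * (o.1.length : ℝ≥0∞)

/-! On a single chain Traversal Verification is Block Verification read backwards: trying the
longest chain first and deleting leaves finds the largest marked block, with the same rates and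
residual laws. So the two output laws agree for every draft (`traversalVerification_chain`).

For the optimality, write E[N] as the sum of P(N > i) over i < γ. Let a(w) be the probability that
the accepted chain of a valid algorithm extends w. Then a(w) ≤ Ms(w), since accepted tokens come
from the draft, and a(wx) ≤ a(w) Mb(x|w), since validity prescribes the law of the token after w
(`IsValid.acceptProb_concat_le`). The recursion for the rates p is exactly the one that combines
these two bounds, so a(w) ≤ Ms(w) p(w) (`IsValid.acceptProb_le`).

Block Verification attains the bound: given the first i + 1 draft tokens w, the probability of τ > i
is p(w). This is a backward induction over the rest of the draft (`expect_noMarkProb`): the rates h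
are tuned so that (1 - h)(S + 1 - p) = 1 - p, where S + 1 - p is the mean of 1 - p over the
children. -/

/-! ### Expectations under a `PMF` -/

namespace PMF

variable {α β : Type*}

/-- The expectation of `f` under `P`. -/
noncomputable def expect (P : PMF α) (f : α → ℝ≥0∞) : ℝ≥0∞ := ∑' a, P a * f a

theorem expect_pure (a : α) (f : α → ℝ≥0∞) : (pure a).expect f = f a := by
  unfold expect
  rw [tsum_eq_single a]
  · simp
  · intro b hb
    simp [hb]

theorem expect_bind (P : PMF α) (k : α → PMF β) (f : β → ℝ≥0∞) :
    (P.bind k).expect f = P.expect fun a => (k a).expect f := by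
  unfold expect
  simp only [bind_apply, ← ENNReal.tsum_mul_right, ← ENNReal.tsum_mul_left]
  rw [ENNReal.tsum_comm]
  simp only [mul_assoc]

theorem expect_map (P : PMF α) (g : α → β) (f : β → ℝ≥0∞) :
    (P.map g).expect f = P.expect fun a => f (g a) := by
  rw [← bind_pure_comp, expect_bind]
  simp only [Function.comp_apply, expect_pure]

theorem expect_const (P : PMF α) (a : ℝ≥0∞) : (P.expect fun _ => a) = a := by
  unfold expect
  rw [ENNReal.tsum_mul_right, P.tsum_coe, one_mul]

theorem expect_add (P : PMF α) (f g : α → ℝ≥0∞) :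
    (P.expect fun a => f a + g a) = P.expect f + P.expect g := by
  simp only [expect, mul_add, ENNReal.tsum_add]

theorem expect_const_mul (P : PMF α) (a : ℝ≥0∞) (f : α → ℝ≥0∞) :
    (P.expect fun x => a * f x) = a * P.expect f := by
  simp only [expect, ← ENNReal.tsum_mul_left, mul_left_comm]

theorem expect_mul_const (P : PMF α) (a : ℝ≥0∞) (f : α → ℝ≥0∞) :
    (P.expect fun x => f x * a) = P.expect f * a := by
  simp only [expect, ← ENNReal.tsum_mul_right, mul_assoc]

theorem expect_sum {ι : Type*} (P : PMF α) (t : Finset ι) (f : ι → α → ℝ≥0∞) :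
    (P.expect fun a => ∑ i ∈ t, f i a) = ∑ i ∈ t, P.expect (f i) := by
  simp only [expect, Finset.mul_sum]
  exact Summable.tsum_finsetSum fun _ _ => ENNReal.summable

theorem expect_tsum {ι : Type*} (P : PMF α) (f : ι → α → ℝ≥0∞) :
    (P.expect fun a => ∑' i, f i a) = ∑' i, P.expect (f i) := by
  simp only [expect, ← ENNReal.tsum_mul_left]
  exact ENNReal.tsum_comm

theorem expect_mono (P : PMF α) {f g : α → ℝ≥0∞} (h : ∀ a ∈ P.support, f a ≤ g a) :
    P.expect f ≤ P.expect g := by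
  refine ENNReal.tsum_le_tsum fun a => ?_
  by_cases ha : a ∈ P.support
  · gcongr
    exact h a ha
  · rw [(P.apply_eq_zero_iff a).2 ha, zero_mul, zero_mul]

theorem expect_congr (P : PMF α) {f g : α → ℝ≥0∞} (h : ∀ a ∈ P.support, f a = g a) :
    P.expect f = P.expect g :=
  le_antisymm (P.expect_mono fun a ha => (h a ha).le) (P.expect_mono fun a ha => (h a ha).ge)

open scoped Classical in
theorem expect_indicator_eq (P : PMF α) (a : α) :
    (P.expect fun b => if b = a then 1 else 0) = P a := by
  unfold expect
  rw [tsum_eq_single a]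
  · simp
  · intro b hb
    simp [hb]

theorem expect_le_one (P : PMF α) {f : α → ℝ≥0∞} (h : ∀ a, f a ≤ 1) : P.expect f ≤ 1 :=
  (P.expect_mono fun a _ => h a).trans (P.expect_const 1).le

end PMF

/-! ### Biased coin flips -/

section withProb

variable {α β : Type*}

theorem withProb_apply (p : ℝ≥0∞) (P Q : PMF α) (a : α) :
    withProb p P Q a = min p 1 * P a + (1 - min p 1) * Q a := rfl

theorem withProb_self (p : ℝ≥0∞) (P : PMF α) : withProb p P P = P := by
  ext a
  rw [withProb_apply, ← add_mul, add_tsub_cancel_of_le (min_le_right p 1), one_mul]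

theorem mem_support_withProb {p : ℝ≥0∞} {P Q : PMF α} {a : α}
    (h : a ∈ (withProb p P Q).support) : a ∈ P.support ∨ a ∈ Q.support := by
  by_contra! hn
  rw [PMF.mem_support_iff, withProb_apply, (P.apply_eq_zero_iff a).2 hn.1,
    (Q.apply_eq_zero_iff a).2 hn.2] at h
  simp at h

theorem expect_withProb (p : ℝ≥0∞) (P Q : PMF α) (f : α → ℝ≥0∞) :
    (withProb p P Q).expect f = min p 1 * P.expect f + (1 - min p 1) * Q.expect f := by
  simp only [PMF.expect, withProb_apply, add_mul, ENNReal.tsum_add, mul_assoc,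
    ENNReal.tsum_mul_left]

theorem withProb_bind (p : ℝ≥0∞) (P Q : PMF α) (k : α → PMF β) :
    (withProb p P Q).bind k = withProb p (P.bind k) (Q.bind k) := by
  ext b
  simp only [PMF.bind_apply, withProb_apply, add_mul, ENNReal.tsum_add, mul_assoc,
    ENNReal.tsum_mul_left]

theorem bind_withProb_const_left (R : PMF α) (p : ℝ≥0∞) (P : PMF β) (k : α → PMF β) :
    (R.bind fun a => withProb p P (k a)) = withProb p P (R.bind k) := by
  ext b
  simp only [PMF.bind_apply, withProb_apply, mul_add, ENNReal.tsum_add, mul_left_comm (R _),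
    ENNReal.tsum_mul_left, ENNReal.tsum_mul_right, R.tsum_coe, one_mul]

end withProb

/-! ### Path probabilities of generated sequences -/

section generate

variable {V : Type*}

/-- The probability that `M` continues the context `c` with the tokens of `w`. -/
noncomputable def pathProb (M : LanguageModel V) : List V → List V → ℝ≥0∞
  | _, [] => 1
  | c, x :: w => M c x * pathProb M (c ++ [x]) w

theorem pathProb_append (M : LanguageModel V) (c u v : List V) :
    pathProb M c (u ++ v) = pathProb M c u * pathProb M (c ++ u) v := by
  induction u generalizing c with
  | nil => simp [pathProb]
  | cons x u ih => simp [pathProb, ih, mul_assoc]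

theorem pathProb_concat (M : LanguageModel V) (c w : List V) (x : V) :
    pathProb M c (w ++ [x]) = pathProb M c w * M (c ++ w) x := by
  simp [pathProb_append, pathProb]

theorem length_of_mem_support_generate (M : LanguageModel V) {c : List V} {n : ℕ} {w : List V}
    (h : w ∈ (generate M c n).support) : w.length = n := by
  induction n generalizing c w with
  | zero =>
    rw [generate, PMF.mem_support_pure_iff] at h
    simp [h]
  | succ n ih =>
    simp only [generate, PMF.mem_support_bind_iff, PMF.mem_support_map_iff] at h
    obtain ⟨t, -, z, hz, rfl⟩ := h
    simp [ih hz]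

theorem expect_generate_succ (M : LanguageModel V) (c : List V) (n : ℕ) (f : List V → ℝ≥0∞) :
    (generate M c (n + 1)).expect f =
      (M c).expect fun t => (generate M (c ++ [t]) n).expect fun z => f (t :: z) := by
  simp only [generate, PMF.expect_bind, PMF.expect_map]

theorem expect_generate_add (M : LanguageModel V) (c : List V) (m n : ℕ) (f : List V → ℝ≥0∞) :
    (generate M c (m + n)).expect f =
      (generate M c m).expect fun w => (generate M (c ++ w) n).expect fun z => f (w ++ z) := by
  induction m generalizing c f with
  | zero => simp [generate, PMF.expect_pure]
  | succ m ih =>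
    rw [add_right_comm, expect_generate_succ, expect_generate_succ]
    simp [ih]

theorem generate_length (M : LanguageModel V) (c w : List V) :
    generate M c w.length w = pathProb M c w := by
  classical
  induction w generalizing c with
  | nil => simp [generate, pathProb]
  | cons x w ih =>
    rw [← PMF.expect_indicator_eq, List.length_cons, expect_generate_succ, pathProb, ← ih]
    unfold PMF.expect
    rw [tsum_eq_single x]
    · rw [← PMF.expect_indicator_eq]
      unfold PMF.expect
      simp
    · intro t ht
      simp [ht]

open scoped Classical in
theorem expect_generate_take (M : LanguageModel V) (c v : List V) {n : ℕ} (h : v.length ≤ n) :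
    ((generate M c n).expect fun z => if z.take v.length = v then 1 else 0) = pathProb M c v := by
  obtain ⟨m, rfl⟩ := Nat.exists_eq_add_of_le h
  rw [expect_generate_add, ← generate_length, ← PMF.expect_indicator_eq]
  refine PMF.expect_congr _ fun w hw => ?_
  have hl := length_of_mem_support_generate M hw
  by_cases hv : w = v <;> simp [← hl, hv, PMF.expect_const]

-- Only an inequality, because the left side vanishes when `v` is longer than `n`.
open scoped Classical in
theorem expect_generate_prefix_le (M : LanguageModel V) (c v : List V) (n : ℕ) :
    ((generate M c n).expect fun z => if v <+: z then 1 else 0) ≤ pathProb M c v := by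
  by_cases h : v.length ≤ n
  · rw [← expect_generate_take M c v h]
    refine PMF.expect_mono _ fun z _ => ?_
    by_cases hz : v <+: z
    · rw [if_pos hz, if_pos (List.prefix_iff_eq_take.1 hz).symm]
    · simp [hz]
  · refine le_trans (le_of_eq ?_) zero_le
    refine (PMF.expect_congr _ fun z hz => if_neg fun hv => h ?_).trans (PMF.expect_const _ 0)
    rw [← length_of_mem_support_generate M hz]
    exact hv.length_le

end generate

/-! ### Traversal Verification on a single chain -/

namespace Forest

variable {V : Type*}

theorem firstChain_chain (w : List V) : (chain w).firstChain = w := by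
  induction w with
  | nil => rfl
  | cons t w ih => simp [chain, firstChain, ih]

theorem deleteFirstLeaf_chain (w : List V) : (chain w).deleteFirstLeaf = chain w.dropLast := by
  induction w with
  | nil => rfl
  | cons t w ih =>
    cases w with
    | nil => rfl
    | cons t' w => simpa [chain, deleteFirstLeaf] using ih

theorem chain_eq_nil_iff (w : List V) : chain w = nil ↔ w = [] := by
  cases w <;> simp [chain]

end Forest

section traversal

variable {V : Type*}

/-- The acceptance rate of the node reached from `X₀` by the tokens `w`, before any deletion. -/
noncomputable def initialRate (Ms Mb : LanguageModel V) (X₀ w : List V) : ℝ≥0∞ :=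
  rateAlong (fun w => Ms (X₀ ++ w)) (fun w => Mb (X₀ ++ w)) [] 1 w

/-- The law of the additional token of Block Verification after accepting `i` tokens of `x`. -/
noncomputable def extraTokenLaw (Ms Mb : LanguageModel V) (X₀ x : List V) (i : ℕ) : PMF V :=
  if i = x.length then Mb (X₀ ++ x.take i)
  else normalizeOr (excess (initialRate Ms Mb X₀ (x.take i)) (Mb (X₀ ++ x.take i))
    (Ms (X₀ ++ x.take i))) (Mb (X₀ ++ x.take i))

/-- The law of the output of Block Verification restricted to its first `n` rounds. -/
noncomputable def blockOutput (Ms Mb : LanguageModel V) (X₀ x : List V) (n : ℕ) :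
    PMF (List V × V) :=
  (blockLength Ms Mb X₀ x n).bind fun τ =>
    (extraTokenLaw Ms Mb X₀ x τ).map fun y => (x.take τ, y)

theorem blockOutput_zero (Ms Mb : LanguageModel V) (X₀ x : List V) :
    blockOutput Ms Mb X₀ x 0 = (extraTokenLaw Ms Mb X₀ x 0).map fun y => ([], y) := by
  simp [blockOutput, blockLength]

theorem blockOutput_succ (Ms Mb : LanguageModel V) (X₀ x : List V) (n : ℕ) :
    blockOutput Ms Mb X₀ x (n + 1) = withProb (blockRate Ms Mb X₀ x (n + 1))
      ((extraTokenLaw Ms Mb X₀ x (n + 1)).map fun y => (x.take (n + 1), y))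
      (blockOutput Ms Mb X₀ x n) := by
  simp only [blockOutput, blockLength, PMF.bind_bind, withProb_bind, PMF.pure_bind]
  exact bind_withProb_const_left _ _ _ _

/-- The loop invariant. Nodes above depth `k` are untouched, while the last node carries the rate
and target law that Block Verification uses there. The draft law at depth `k` is left free: once the
child is deleted, no later step on a chain reads it. -/
theorem traversalLoop_chain_take (Ms Mb : LanguageModel V) (X₀ x : List V) (k : ℕ)
    (hk : k ≤ x.length) (s b : List V → PMF V) (p : List V → ℝ≥0∞)
    (hs : ∀ j < k, s (x.take j) = Ms (X₀ ++ x.take j))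
    (hb : ∀ j < k, b (x.take j) = Mb (X₀ ++ x.take j))
    (hp : ∀ j < k, p (x.take j) = initialRate Ms Mb X₀ (x.take j))
    (hbk : b (x.take k) = extraTokenLaw Ms Mb X₀ x k)
    (hpk : p (x.take k) = blockRate Ms Mb X₀ x k) :
    traversalLoop s b p (Forest.chain (x.take k)) = blockOutput Ms Mb X₀ x k := by
  classical
  induction k generalizing s b p with
  | zero =>
    rw [List.take_zero] at hbk
    rw [traversalLoop, blockOutput_zero, ← hbk]
    simp only [List.take_zero, Forest.chain, Forest.firstChain, if_true]
    -- At the root, acceptance and rejection both output the empty chain, so the rate there has no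
    -- influence.
    exact withProb_self _ _
  | succ k ih =>
    have hne : x.take (k + 1) ≠ [] := by
      intro h
      have := congrArg List.length h
      simp at this
      simp [this] at hk
    have hdrop : (x.take (k + 1)).dropLast = x.take k := by
      rw [List.dropLast_eq_take, List.take_take, List.length_take]
      congr 1
      omega
    have htake : ∀ j < k, x.take j ≠ x.take k := by
      intro j hj h
      have := congrArg List.length h
      simp only [List.length_take] at this
      omega
    rw [traversalLoop, blockOutput_succ]
    simp only [Forest.firstChain_chain, Forest.deleteFirstLeaf_chain, Forest.chain_eq_nil_iff,
      if_neg hne, hdrop]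
    rw [hbk, hpk]
    congr 1
    refine ih (by omega) _ _ _ ?_ ?_ ?_ ?_ ?_
    · intro j hj
      rw [Function.update_of_ne (htake j hj), hs j (by omega)]
    · intro j hj
      rw [Function.update_of_ne (htake j hj), hb j (by omega)]
    · intro j hj
      rw [if_neg, hp j (by omega)]
      intro h
      have := h.length_le
      simp only [List.length_take] at this
      omega
    · rw [Function.update_self, extraTokenLaw, if_neg (by omega), hs k (by omega), hb k (by omega),
        hp k (by omega)]
    · rw [if_pos List.prefix_rfl, List.drop_length, rateAlong, blockRate, if_neg (by omega),
        hs k (by omega), hb k (by omega), hp k (by omega), initialRate]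

theorem traversalVerification_chain (Ms Mb : LanguageModel V) (X₀ x : List V) :
    traversalVerification Ms Mb X₀ (Forest.chain x) = blockVerification Ms Mb X₀ x := by
  have h := traversalLoop_chain_take Ms Mb X₀ x x.length le_rfl (fun w => Ms (X₀ ++ w))
    (fun w => Mb (X₀ ++ w)) (initialRate Ms Mb X₀) (fun _ _ => rfl) (fun _ _ => rfl)
    (fun _ _ => rfl) (by rw [extraTokenLaw, if_pos rfl]) (by rw [blockRate, if_pos rfl, initialRate])
  rw [List.take_length] at h
  exact h

end traversal

/-! ### One-step identities for the rates -/

section rates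

variable {V : Type*}

theorem rateAlong_append (s b : List V → PMF V) (c : List V) (r : ℝ≥0∞) (u v : List V) :
    rateAlong s b c r (u ++ v) = rateAlong s b (c ++ u) (rateAlong s b c r u) v := by
  induction u generalizing c r with
  | nil => simp [rateAlong]
  | cons x u ih => simp [rateAlong, ih]

theorem rateAlong_le_one (s b : List V → PMF V) (c : List V) {r : ℝ≥0∞} (hr : r ≤ 1)
    (w : List V) : rateAlong s b c r w ≤ 1 := by
  induction w generalizing c r with
  | nil => exact hr
  | cons x w ih => exact ih _ (min_le_right _ _)

theorem initialRate_le_one (Ms Mb : LanguageModel V) (X₀ w : List V) :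
    initialRate Ms Mb X₀ w ≤ 1 :=
  rateAlong_le_one _ _ _ le_rfl w

theorem initialRate_concat (Ms Mb : LanguageModel V) (X₀ w : List V) (x : V) :
    initialRate Ms Mb X₀ (w ++ [x]) =
      min (initialRate Ms Mb X₀ w * Mb (X₀ ++ w) x / Ms (X₀ ++ w) x) 1 := by
  simp [initialRate, rateAlong_append, rateAlong]

/-- Where `s x = 0` the value of the division is irrelevant: both sides are zero. -/
theorem mul_min_mul_div_one (r : ℝ≥0∞) (b s : PMF V) (x : V) :
    s x * min (r * b x / s x) 1 = min (r * b x) (s x) := by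
  by_cases h : s x = 0
  · simp [h]
  · rw [mul_min, mul_one, ENNReal.mul_div_cancel h (s.apply_ne_top x)]

theorem tsum_excess_le (r : ℝ≥0∞) (b s : PMF V) : ∑' x, excess r b s x ≤ r := by
  refine (ENNReal.tsum_le_tsum fun x => tsub_le_self).trans ?_
  rw [ENNReal.tsum_mul_left, b.tsum_coe, mul_one]

/-- The rates of the children of a node of rate `r`, averaged over the draft law. -/
theorem expect_one_sub_min (r : ℝ≥0∞) (hr : r ≤ 1) (b s : PMF V) :
    (s.expect fun x => 1 - min (r * b x / s x) 1) = ∑' x, excess r b s x + (1 - r) := by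
  have hr' : r ≠ ∞ := (hr.trans_lt ENNReal.one_lt_top).ne
  have key : (s.expect fun x => 1 - min (r * b x / s x) 1) + r = ∑' x, excess r b s x + 1 := by
    have h1 : r = ∑' x, r * b x := by rw [ENNReal.tsum_mul_left, b.tsum_coe, mul_one]
    -- With `r` and `1` expanded as sums over tokens, the claim holds termwise: (s - min(rb, s)) +
    -- rb = [rb - s]₊ + s.
    conv_lhs => enter [2]; rw [h1]
    rw [← s.tsum_coe, PMF.expect, ← ENNReal.tsum_add, ← ENNReal.tsum_add]
    refine tsum_congr fun x => ?_
    rw [ENNReal.mul_sub (fun _ _ => s.apply_ne_top x), s.tsum_coe, mul_one, mul_min_mul_div_one,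
      excess]
    rcases le_total (r * b x) (s x) with h | h
    · rw [min_eq_left h, tsub_add_cancel_of_le h, tsub_eq_zero_of_le h, zero_add]
    · rw [min_eq_right h, tsub_self, zero_add, tsub_add_cancel_of_le h]
  rw [← ENNReal.add_left_inj hr', key, add_assoc, tsub_add_cancel_of_le hr]

theorem residualRate_le_one (r : ℝ≥0∞) (b s : PMF V) : residualRate r b s ≤ 1 :=
  ENNReal.div_le_of_le_mul (by rw [one_mul]; exact le_self_add)

/-- The product form also covers a zero denominator, which forces `r = 1`, so that both sides
vanish. -/
theorem one_sub_residualRate_mul (r : ℝ≥0∞) (hr : r ≤ 1) (b s : PMF V) :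
    (1 - residualRate r b s) * (∑' x, excess r b s x + (1 - r)) = 1 - r := by
  have hS : ∑' x, excess r b s x ≠ ∞ :=
    ((tsum_excess_le r b s).trans_lt (hr.trans_lt ENNReal.one_lt_top)).ne
  have hT : ∑' x, excess r b s x + (1 - r) ≠ ∞ :=
    ENNReal.add_ne_top.2 ⟨hS, (tsub_le_self.trans_lt ENNReal.one_lt_top).ne⟩
  by_cases h0 : ∑' x, excess r b s x + (1 - r) = 0
  · rw [h0, mul_zero, (add_eq_zero.1 h0).2]
  · rw [ENNReal.sub_mul (fun _ _ => hT), one_mul, residualRate, ENNReal.div_mul_cancel h0 hT,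
      ENNReal.add_sub_cancel_left hS]

/-- The probability that Block Verification does not mark any block of a chain which extends a node
`c` of rate `r` by `w`, starting from the block that ends in `c`. -/
noncomputable def noMarkProb (s b : List V → PMF V) : List V → ℝ≥0∞ → List V → ℝ≥0∞
  | _, r, [] => 1 - r
  | c, r, x :: w => (1 - residualRate r (b c) (s c)) *
      noMarkProb s b (c ++ [x]) (min (r * b c x / s c x) 1) w

/-- The rate at `c` does not depend on the continuation and factors out. By induction what remains
is the mean of 1 minus the child's rate, that is S + 1 - r, and the factor 1 - h turns it back into
1 - r. -/
theorem expect_noMarkProb (Ms Mb : LanguageModel V) (X₀ c : List V) {r : ℝ≥0∞} (hr : r ≤ 1)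
    (n : ℕ) :
    ((generate Ms (X₀ ++ c) n).expect fun w =>
      noMarkProb (fun w => Ms (X₀ ++ w)) (fun w => Mb (X₀ ++ w)) c r w) = 1 - r := by
  induction n generalizing c r with
  | zero => simp [generate, PMF.expect_pure, noMarkProb]
  | succ n ih =>
    rw [expect_generate_succ]
    simp only [noMarkProb, PMF.expect_const_mul]
    simp only [List.append_assoc, ih _ (min_le_right _ _)]
    rw [expect_one_sub_min r hr, one_sub_residualRate_mul r hr]

end rates

/-! ### The accepted length of Block Verification -/

section block

variable {V : Type*}

theorem blockRate_le_one (Ms Mb : LanguageModel V) (X₀ x : List V) (i : ℕ) :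
    blockRate Ms Mb X₀ x i ≤ 1 := by
  unfold blockRate
  split_ifs
  · exact rateAlong_le_one _ _ _ le_rfl _
  · exact residualRate_le_one _ _ _

theorem prod_one_sub_blockRate (Ms Mb : LanguageModel V) (X₀ w y : List V) :
    ∏ j ∈ Finset.Ico w.length (w.length + y.length + 1), (1 - blockRate Ms Mb X₀ (w ++ y) j) =
      noMarkProb (fun w => Ms (X₀ ++ w)) (fun w => Mb (X₀ ++ w)) w (initialRate Ms Mb X₀ w) y := by
  induction y generalizing w with
  | nil => simp [blockRate, noMarkProb, initialRate]
  | cons x y ih =>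
    have h := ih (w ++ [x])
    rw [initialRate_concat] at h
    simp only [List.append_assoc, List.singleton_append, List.length_append, List.length_cons,
      List.length_nil, zero_add] at h
    rw [Finset.prod_eq_prod_Ico_succ_bot (by simp), noMarkProb, ← h]
    congr 1
    · simp [blockRate, initialRate]
    · congr 2
      simp only [List.length_cons]
      omega

theorem le_of_mem_support_blockLength {Ms Mb : LanguageModel V} {X₀ x : List V} {n τ : ℕ}
    (h : τ ∈ (blockLength Ms Mb X₀ x n).support) : τ ≤ n := by
  induction n generalizing τ with
  | zero => simpa [blockLength] using h
  | succ n ih =>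
    rw [blockLength, PMF.mem_support_bind_iff] at h
    obtain ⟨σ, hσ, h⟩ := h
    have := ih hσ
    rcases mem_support_withProb h with h | h <;> rw [PMF.mem_support_pure_iff] at h <;> omega

/-- A later mark overrides earlier ones, so τ stays below `i` iff all rounds from `i` on fail. For
`i = 0` this breaks down, since τ starts at 0. -/
theorem expect_blockLength_lt (Ms Mb : LanguageModel V) (X₀ x : List V) {i n : ℕ}
    (hi : 0 < i) (hn : i ≤ n + 1) :
    ((blockLength Ms Mb X₀ x n).expect fun τ => if τ < i then 1 else 0) =
      ∏ j ∈ Finset.Ico i (n + 1), (1 - blockRate Ms Mb X₀ x j) := by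
  induction n with
  | zero =>
    obtain rfl : i = 1 := by omega
    simp [blockLength, PMF.expect_pure]
  | succ n ih =>
    simp only [blockLength, PMF.expect_bind, expect_withProb, PMF.expect_pure,
      min_eq_left (blockRate_le_one Ms Mb X₀ x (n + 1))]
    rcases hn.lt_or_eq with h | rfl
    · rw [Finset.prod_Ico_succ_top (by omega), ← ih (by omega), if_neg (by omega), mul_zero,
        mul_comm, ← PMF.expect_const_mul]
      simp only [zero_add]
    · rw [Finset.Ico_self, Finset.prod_empty]
      refine (PMF.expect_congr _ fun τ hτ => ?_).trans (PMF.expect_const _ 1)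
      have := le_of_mem_support_blockLength hτ
      rw [if_pos (by omega), if_pos (by omega), mul_one, mul_one,
        add_tsub_cancel_of_le (blockRate_le_one Ms Mb X₀ x (n + 1))]

end block

/-! ### Tail sums for Block Verification -/

section expectedAccepted

variable {V : Type*}

theorem sum_range_ite_lt (n γ : ℕ) (h : n ≤ γ) :
    ∑ i ∈ Finset.range γ, (if i < n then 1 else 0 : ℝ≥0∞) = n := by
  rw [← Finset.sum_filter]
  have : (Finset.range γ).filter (· < n) = Finset.range n := by
    ext i
    simp only [Finset.mem_filter, Finset.mem_range]
    omega
  simp [this]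

theorem expect_generate_blockLength (Ms Mb : LanguageModel V) (X₀ : List V) {i γ : ℕ}
    (hi : i < γ) :
    ((generate Ms X₀ γ).expect fun x =>
      (blockLength Ms Mb X₀ x γ).expect fun τ => if i < τ then 1 else 0) =
      (generate Ms X₀ (i + 1)).expect (initialRate Ms Mb X₀) := by
  have hlt : ((generate Ms X₀ γ).expect fun x =>
      (blockLength Ms Mb X₀ x γ).expect fun τ => if τ < i + 1 then 1 else 0) =
      (generate Ms X₀ (i + 1)).expect fun w => 1 - initialRate Ms Mb X₀ w := by
    -- The draft splits into its first `i + 1` tokens, which fix the rate, and `m` further tokens to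
    -- average over.
    obtain ⟨m, rfl⟩ := Nat.exists_eq_add_of_le (Nat.succ_le_of_lt hi)
    rw [Nat.succ_eq_add_one, expect_generate_add]
    refine PMF.expect_congr _ fun w hw => ?_
    rw [← expect_noMarkProb Ms Mb X₀ w (initialRate_le_one Ms Mb X₀ w) m]
    refine PMF.expect_congr _ fun z hz => ?_
    rw [expect_blockLength_lt Ms Mb X₀ _ (by omega) (by omega), ← prod_one_sub_blockRate,
      length_of_mem_support_generate Ms hw, length_of_mem_support_generate Ms hz]
  have htop : ((generate Ms X₀ (i + 1)).expect fun w => 1 - initialRate Ms Mb X₀ w) ≠ ∞ :=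
    ((PMF.expect_le_one _ fun _ => tsub_le_self).trans_lt ENNReal.one_lt_top).ne
  rw [← ENNReal.add_left_inj htop, ← PMF.expect_add, ← hlt, ← PMF.expect_add]
  simp only [← PMF.expect_add, add_tsub_cancel_of_le (initialRate_le_one Ms Mb X₀ _)]
  rw [PMF.expect_const]
  refine (PMF.expect_congr _ fun x _ => (PMF.expect_congr _ fun τ _ => ?_).trans
    (PMF.expect_const _ 1)).trans (PMF.expect_const _ 1)
  by_cases h : i < τ
  · rw [if_pos h, if_neg (by omega), add_zero]
  · rw [if_neg h, if_pos (by omega), zero_add]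

theorem expectedAccepted_blockVerification (Ms Mb : LanguageModel V) (X₀ : List V) (γ : ℕ) :
    expectedAccepted Ms X₀ γ (fun x => blockVerification Ms Mb X₀ x) =
      ∑ i ∈ Finset.range γ, (generate Ms X₀ (i + 1)).expect (initialRate Ms Mb X₀) := by
  have h : expectedAccepted Ms X₀ γ (fun x => blockVerification Ms Mb X₀ x) =
      (generate Ms X₀ γ).expect fun x =>
        (blockOutput Ms Mb X₀ x x.length).expect fun o => (o.1.length : ℝ≥0∞) :=
    PMF.expect_bind _ _ fun o : List V × V => (o.1.length : ℝ≥0∞)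
  rw [h, ← Finset.sum_congr rfl fun i hi =>
    expect_generate_blockLength Ms Mb X₀ (Finset.mem_range.1 hi), ← PMF.expect_sum]
  refine PMF.expect_congr _ fun x hx => ?_
  rw [blockOutput, PMF.expect_bind, ← PMF.expect_sum, length_of_mem_support_generate Ms hx]
  refine PMF.expect_congr _ fun τ hτ => ?_
  have := le_of_mem_support_blockLength hτ
  rw [PMF.expect_map, sum_range_ite_lt _ _ this]
  refine (PMF.expect_const _ ((x.take τ).length : ℝ≥0∞)).trans ?_
  rw [List.length_take, length_of_mem_support_generate Ms hx, min_eq_left this]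

end expectedAccepted

/-! ### The upper bound for valid algorithms -/

namespace ChainVerifier

variable {V : Type*}

/-- The joint law of the accepted chain and the additional token. -/
noncomputable def outputLaw (A : ChainVerifier V) (Ms Mb : LanguageModel V) (X₀ : List V)
    (γ : ℕ) : PMF (List V × V) :=
  (generate Ms X₀ γ).bind fun x => A.run Ms Mb X₀ x

open scoped Classical in
/-- The probability that the accepted chain starts with `w`. -/
noncomputable def acceptProb (A : ChainVerifier V) (Ms Mb : LanguageModel V) (X₀ : List V)
    (γ : ℕ) (w : List V) : ℝ≥0∞ :=
  (A.outputLaw Ms Mb X₀ γ).expect fun o => if w <+: o.1 then 1 else 0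

theorem acceptProb_le_pathProb (A : ChainVerifier V) (Ms Mb : LanguageModel V) (X₀ : List V)
    (γ : ℕ) (w : List V) : A.acceptProb Ms Mb X₀ γ w ≤ pathProb Ms X₀ w := by
  classical
  refine le_trans ?_ (expect_generate_prefix_le Ms X₀ w γ)
  rw [acceptProb, outputLaw, PMF.expect_bind]
  refine PMF.expect_mono _ fun x _ => ?_
  refine (PMF.expect_mono _ fun o ho => ?_).trans_eq (PMF.expect_const _ _)
  by_cases hw : w <+: o.1
  · rw [if_pos hw, if_pos (hw.trans (A.accepted_subchain _ _ _ _ o ho))]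
  · simp [hw]

open scoped Classical in
/-- The probability that the output `o`, continued by `Mb`, starts with `v`. -/
noncomputable def continuationProb (Mb : LanguageModel V) (X₀ : List V) (o : List V × V)
    (v : List V) : ℝ≥0∞ :=
  (generate Mb (X₀ ++ o.1 ++ [o.2]) v.length).expect fun z =>
    if (o.1 ++ o.2 :: z).take v.length = v then 1 else 0

theorem IsValid.expect_continuationProb {A : ChainVerifier V} {Ms Mb : LanguageModel V}
    {X₀ : List V} {γ : ℕ} (hA : A.IsValid Ms Mb X₀ γ) (v : List V) :
    ((A.outputLaw Ms Mb X₀ γ).expect fun o => continuationProb Mb X₀ o v) = pathProb Mb X₀ v := by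
  classical
  have h := hA v.length
  rw [← PMF.bind_bind] at h
  rw [← generate_length, ← h, ← PMF.expect_indicator_eq, PMF.expect_bind]
  simp only [PMF.expect_map]
  exact PMF.expect_congr _ fun o _ => PMF.expect_congr _ fun z _ => by congr

theorem continuationProb_of_prefix (Mb : LanguageModel V) (X₀ : List V) (o : List V × V)
    {v : List V} (h : v <+: o.1) : continuationProb Mb X₀ o v = 1 := by
  refine (PMF.expect_congr _ fun z _ => if_pos ?_).trans (PMF.expect_const _ 1)
  exact (List.prefix_iff_eq_take.1 (h.trans (List.prefix_append _ _))).symm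

theorem continuationProb_of_not_prefix (Mb : LanguageModel V) (X₀ : List V) (o : List V × V)
    {v : List V} (h : ¬ o.1 ++ [o.2] <+: v) (h' : ¬ v <+: o.1) :
    continuationProb Mb X₀ o v = 0 := by
  refine (PMF.expect_congr _ fun z _ => if_neg fun hv => ?_).trans (PMF.expect_const _ 0)
  have hv : v <+: o.1 ++ [o.2] ++ z := by
    rw [← hv, List.append_assoc]
    exact List.take_prefix _ _
  rcases List.prefix_or_prefix_of_prefix hv (List.prefix_append _ _) with hv | hv
  · rcases List.prefix_concat_iff.1 hv with rfl | hv
    · exact h List.prefix_rfl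
    · exact h' hv
  · exact h hv

theorem continuationProb_append (Mb : LanguageModel V) (X₀ : List V) (o : List V × V)
    (v : List V) :
    continuationProb Mb X₀ o (o.1 ++ o.2 :: v) = pathProb Mb (X₀ ++ o.1 ++ [o.2]) v := by
  classical
  rw [← expect_generate_take Mb _ v (n := (o.1 ++ o.2 :: v).length) (by simp; omega)]
  refine PMF.expect_congr _ fun z _ => ?_
  have : (o.1 ++ o.2 :: z).take (o.1 ++ o.2 :: v).length = o.1 ++ o.2 :: z.take v.length := by
    rw [List.length_append, List.take_length_add_append]
    simp
  exact if_congr (by rw [this]; simp) rfl rfl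

/-- If `w` is not within the accepted chain, then either `w` already contains the additional token
and its next token comes from `Mb`, or `w` contradicts the output and both sides are zero. -/
theorem continuationProb_concat (Mb : LanguageModel V) (X₀ : List V) (o : List V × V)
    {w : List V} (h : ¬ w <+: o.1) (x : V) :
    continuationProb Mb X₀ o (w ++ [x]) = continuationProb Mb X₀ o w * Mb (X₀ ++ w) x := by
  by_cases hw : o.1 ++ [o.2] <+: w
  · obtain ⟨v, rfl⟩ := hw
    have h1 := continuationProb_append Mb X₀ o v
    have h2 := continuationProb_append Mb X₀ o (v ++ [x])
    rw [pathProb_concat, ← h1] at h2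
    simpa using h2
  · rw [continuationProb_of_not_prefix Mb X₀ o hw h, zero_mul]
    refine continuationProb_of_not_prefix Mb X₀ o (fun hx => ?_) fun hx =>
      h ((List.prefix_append _ _).trans hx)
    rcases List.prefix_concat_iff.1 hx with hx | hx
    · exact h ((List.append_inj' hx rfl).1 ▸ List.prefix_rfl)
    · exact hw hx

/-- Let R be the probability that the continued output starts with `w` although `w` is not within
the accepted chain. Validity gives Mb(w) = a(w) + R and Mb(wx) ≥ a(wx) + R Mb(x|w); subtracting R
Mb(x|w) leaves the claim. -/
theorem IsValid.acceptProb_concat_le {A : ChainVerifier V} {Ms Mb : LanguageModel V}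
    {X₀ : List V} {γ : ℕ} (hA : A.IsValid Ms Mb X₀ γ) (w : List V) (x : V) :
    A.acceptProb Ms Mb X₀ γ (w ++ [x]) ≤ A.acceptProb Ms Mb X₀ γ w * Mb (X₀ ++ w) x := by
  classical
  set R := (A.outputLaw Ms Mb X₀ γ).expect fun o =>
    if w <+: o.1 then 0 else continuationProb Mb X₀ o w with hR
  have hle : ∀ (o : List V × V) (v : List V), continuationProb Mb X₀ o v ≤ 1 := fun o v =>
    PMF.expect_le_one _ fun z => by split_ifs <;> simp
  have h1 : pathProb Mb X₀ w = A.acceptProb Ms Mb X₀ γ w + R := by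
    rw [← hA.expect_continuationProb, acceptProb, hR, ← PMF.expect_add]
    refine PMF.expect_congr _ fun o _ => ?_
    by_cases hw : w <+: o.1
    · simp [hw, continuationProb_of_prefix]
    · simp [hw]
  -- The inequality drops the outputs with accepted chain exactly `w` and additional token `x`.
  have h2 : A.acceptProb Ms Mb X₀ γ (w ++ [x]) + R * Mb (X₀ ++ w) x ≤
      pathProb Mb X₀ (w ++ [x]) := by
    rw [← hA.expect_continuationProb, acceptProb, hR, ← PMF.expect_mul_const, ← PMF.expect_add]
    refine PMF.expect_mono _ fun o _ => ?_
    by_cases hw : w <+: o.1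
    · by_cases hx : w ++ [x] <+: o.1
      · simp [hw, hx, continuationProb_of_prefix]
      · simp [hw, hx]
    · have hx : ¬ w ++ [x] <+: o.1 := fun hx => hw ((List.prefix_append _ _).trans hx)
      simp [hw, hx, continuationProb_concat]
  have hfin : R * Mb (X₀ ++ w) x ≠ ∞ := by
    refine ENNReal.mul_ne_top (lt_of_le_of_lt ?_ ENNReal.one_lt_top).ne (PMF.apply_ne_top _ _)
    exact PMF.expect_le_one _ fun o => by split_ifs <;> simp [hle]
  rw [pathProb_concat, h1, add_mul] at h2
  exact (ENNReal.add_le_add_iff_right hfin).1 h2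

theorem IsValid.acceptProb_le {A : ChainVerifier V} {Ms Mb : LanguageModel V}
    {X₀ : List V} {γ : ℕ} (hA : A.IsValid Ms Mb X₀ γ) (w : List V) :
    A.acceptProb Ms Mb X₀ γ w ≤ pathProb Ms X₀ w * initialRate Ms Mb X₀ w := by
  induction w using List.reverseRecOn with
  | nil => simpa [initialRate, rateAlong] using A.acceptProb_le_pathProb Ms Mb X₀ γ []
  | append_singleton w x ih =>
    rw [pathProb_concat, initialRate_concat, mul_assoc, mul_min_mul_div_one, mul_min]
    refine le_min ?_ ?_
    · rw [← mul_assoc]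
      exact (hA.acceptProb_concat_le w x).trans (by gcongr)
    · rw [← pathProb_concat]
      exact A.acceptProb_le_pathProb Ms Mb X₀ γ _

theorem length_le_of_mem_support_outputLaw {A : ChainVerifier V} {Ms Mb : LanguageModel V}
    {X₀ : List V} {γ : ℕ} {o : List V × V} (ho : o ∈ (A.outputLaw Ms Mb X₀ γ).support) :
    o.1.length ≤ γ := by
  rw [outputLaw, PMF.mem_support_bind_iff] at ho
  obtain ⟨x, hx, ho⟩ := ho
  rw [← length_of_mem_support_generate Ms hx]
  exact (A.accepted_subchain _ _ _ _ o ho).length_le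

theorem IsValid.expect_ite_lt_length_le {A : ChainVerifier V} {Ms Mb : LanguageModel V}
    {X₀ : List V} {γ : ℕ} (hA : A.IsValid Ms Mb X₀ γ) (i : ℕ) :
    ((A.outputLaw Ms Mb X₀ γ).expect fun o => if i < o.1.length then 1 else 0) ≤
      (generate Ms X₀ (i + 1)).expect (initialRate Ms Mb X₀) := by
  classical
  -- A union over words of length `i + 1`: a longer accepted chain contributes through its own
  -- initial part of that length.
  calc _ ≤ (A.outputLaw Ms Mb X₀ γ).expect fun o =>
        ∑' w : List V, (if w.length = i + 1 then 1 else 0) * (if w <+: o.1 then 1 else 0) := by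
        refine PMF.expect_mono _ fun o _ => ?_
        split_ifs with h
        · refine le_trans (le_of_eq ?_) (ENNReal.le_tsum (o.1.take (i + 1)))
          rw [if_pos (by simp; omega), if_pos (List.take_prefix _ _), one_mul]
        · exact zero_le
    _ = ∑' w : List V, (if w.length = i + 1 then 1 else 0) * A.acceptProb Ms Mb X₀ γ w := by
        rw [PMF.expect_tsum]
        simp only [PMF.expect_const_mul, acceptProb]
    _ ≤ ∑' w : List V, generate Ms X₀ (i + 1) w * initialRate Ms Mb X₀ w := by
        refine ENNReal.tsum_le_tsum fun w => ?_
        split_ifs with h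
        · rw [one_mul, ← h, generate_length]
          exact hA.acceptProb_le w
        · simp

theorem IsValid.expectedAccepted_le {A : ChainVerifier V} {Ms Mb : LanguageModel V}
    {X₀ : List V} {γ : ℕ} (hA : A.IsValid Ms Mb X₀ γ) :
    expectedAccepted Ms X₀ γ (fun x => A.run Ms Mb X₀ x) ≤
      ∑ i ∈ Finset.range γ, (generate Ms X₀ (i + 1)).expect (initialRate Ms Mb X₀) := by
  calc expectedAccepted Ms X₀ γ (fun x => A.run Ms Mb X₀ x)
      = (A.outputLaw Ms Mb X₀ γ).expect fun o => (o.1.length : ℝ≥0∞) := rfl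
    _ = (A.outputLaw Ms Mb X₀ γ).expect fun o =>
          ∑ i ∈ Finset.range γ, if i < o.1.length then 1 else 0 :=
        PMF.expect_congr _ fun o ho =>
          (sum_range_ite_lt _ _ (length_le_of_mem_support_outputLaw ho)).symm
    _ ≤ _ := by
        rw [PMF.expect_sum]
        exact Finset.sum_le_sum fun i _ => hA.expect_ite_lt_length_le i

end ChainVerifier

theorem theorem2 {V : Type*} (Ms Mb : LanguageModel V) (X₀ : List V) (γ : ℕ) :
    expectedAccepted Ms X₀ γ (fun x => traversalVerification Ms Mb X₀ (Forest.chain x)) =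
        expectedAccepted Ms X₀ γ (fun x => blockVerification Ms Mb X₀ x) ∧
      ∀ A : ChainVerifier V, A.IsValid Ms Mb X₀ γ →
        expectedAccepted Ms X₀ γ (fun x => A.run Ms Mb X₀ x) ≤
          expectedAccepted Ms X₀ γ (fun x => blockVerification Ms Mb X₀ x) := by
  refine ⟨?_, fun A hA => ?_⟩
  · simp only [traversalVerification_chain]
  · rw [expectedAccepted_blockVerification]
    exact hA.expectedAccepted_le
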